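/- Let $H$ be a complex Hilbert space and let $A:\mathcal D(A)\subset H\to H$ generate a bounded $C_0$-semigroup $(S(t))_{t\ge 0}$ on $H$. Let $\alpha>0$ and suppose that $S$ is polynomially stable of order $1/\alpha$, i.e. $0\in\rho(A)$ and, for some constant $C$, $\|S(t)A^{-1}\|_{\mathcal L(H)}\le C(1+t)^{-1/\alpha}$ for all $t\ge 0$. For $T>0$ and $r\ge 0$ let $H^r_\#(0,T;H)$ be the space of $T$-periodic functions $F:\mathbb R\to H$ (modulo equality almost everywhere), square integrable over a period, with $$\|F\|_{H^r_\#}^2=\sum_{n\in\mathbb Z}(1+|n|)^{2r}\|F_n\|_H^2<\infty,\qquad F_n=\frac1T\int_0^T e^{-2\pi i n t/T}F(t)\,dt .$$ A $T$-periodic mild solution of $U_t=AU+F$ is a continuous $T$-periodic function $U:\mathbb R\to H$ with $U(t)=S(t)U(0)+\int_0^t S(t-s)F(s)\,ds$ for $0\le t\le T$. Then $i\mathbb R\subset\rho(A)$ and there is a constant $C'$ with $\|(is-A)^{-1}\|_{\mathcal L(H)}\le C'(1+|s|)^{\alpha}$ for all $s\in\mathbb R$. Moreover, for every $T>0$ there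 is a constant $C_T$ such that for every real $m\ge 1$ and every $F\in H^{m+\alpha}_\#(0,T;H)$, the equation $U_t=AU+F$ has a unique $T$-periodic mild solution $U$, and this solution lies in $H^m_\#(0,T;H)$ and satisfies $$\|U\|_{H^m_\#}\le C_T\,\|F\|_{H^{m+\alpha}_\#}.$$ Thus the loss of time derivatives is the exponent $\alpha$ that bounds the growth of the resolvent on $i\mathbb R$. -/

import Mathlib

open Filter Topology MeasureTheory

noncomputable section

/-- `S` is a `C₀`-semigroup of bounded operators on `H`: `S 0 = I`, `S (s + t) = S s S t` for
`s, t ≥ 0`, and every orbit is continuous on `[0, ∞)`. The values `S t` for `t < 0` play no role. -/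
structure IsC0Semigroup {H : Type*} [NormedAddCommGroup H] [InnerProductSpace ℂ H]
    (S : ℝ → H →L[ℂ] H) : Prop where
  map_zero : S 0 = ContinuousLinearMap.id ℂ H
  map_add : ∀ s t : ℝ, 0 ≤ s → 0 ≤ t → S (s + t) = (S s).comp (S t)
  continuousOn : ∀ x : H, ContinuousOn (fun t : ℝ => S t x) (Set.Ici 0)

/-- `A`, with its domain, is the infinitesimal generator of `S`: `x` lies in the domain with
`A x = y` exactly when `(S h x - x) / h → y` as `h → 0+`. -/
def IsGenerator {H : Type*} [NormedAddCommGroup H] [InnerProductSpace ℂ H]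
    (A : H →ₗ.[ℂ] H) (S : ℝ → H →L[ℂ] H) : Prop :=
  ∀ x y : H, (x, y) ∈ A.graph ↔
    Tendsto (fun h : ℝ => h⁻¹ • (S h x - x)) (𝓝[>] 0) (𝓝 y)

/-- The bounded operator `B` on `H` is the inverse of the unbounded operator `A`, which is then a
bijection from its domain onto `H`. -/
structure IsBoundedInverse {H : Type*} [NormedAddCommGroup H] [InnerProductSpace ℂ H]
    (A : H →ₗ.[ℂ] H) (B : H →L[ℂ] H) : Prop where
  left_inv : ∀ x : A.domain, B (A x) = x
  right_inv : ∀ y : H, ∃ x : A.domain, (x : H) = B y ∧ A x = y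

/-- `z` is in the resolvent set of `A` and the bounded operator `R` is `(z I - A)⁻¹`. -/
structure IsResolventAt {H : Type*} [NormedAddCommGroup H] [InnerProductSpace ℂ H]
    (A : H →ₗ.[ℂ] H) (z : ℂ) (R : H →L[ℂ] H) : Prop where
  left_inv : ∀ x : A.domain, R (z • (x : H) - A x) = x
  right_inv : ∀ y : H, ∃ x : A.domain, (x : H) = R y ∧ z • (x : H) - A x = y

/-- Polynomial stability of order `1 / α` of the semigroup `S` with generator `A`: `α > 0`, the
operator `A` has a bounded inverse, and `‖S t A⁻¹‖ ≤ C (1 + t) ^ (-1 / α)` for all `t ≥ 0`. -/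
def IsPolynomiallyStable {H : Type*} [NormedAddCommGroup H] [InnerProductSpace ℂ H]
    (A : H →ₗ.[ℂ] H) (S : ℝ → H →L[ℂ] H) (α : ℝ) : Prop :=
  0 < α ∧ ∃ B : H →L[ℂ] H, IsBoundedInverse A B ∧
    ∃ C : ℝ, ∀ t : ℝ, 0 ≤ t → ‖(S t).comp B‖ ≤ C * (1 + t) ^ (-(1 / α))

/-- The space `H^r_#(0,T;H)`: `T`-periodic functions, square integrable over a period, whose
Fourier coefficients `F_n = (1/T) ∫_0^T exp (-2 π i n t / T) F t dt` satisfy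
`∑ (1 + |n|) ^ (2 r) ‖F_n‖ ^ 2 < ∞`. Functions are periodic representatives of their classes
modulo equality almost everywhere. -/
structure MemHper {H : Type*} [NormedAddCommGroup H] [InnerProductSpace ℂ H]
    {T : ℝ} (hT : 0 < T) (r : ℝ) (F : ℝ → H) : Prop where
  periodic : Function.Periodic F T
  memLp : MemLp F 2 (volume.restrict (Set.Ioc 0 T))
  summable : Summable fun n : ℤ =>
    (1 + |(n : ℝ)|) ^ (2 * r) * ‖fourierCoeffOn hT F n‖ ^ 2

/-- The norm of `H^r_#(0,T;H)`, the square root of `∑ (1 + |n|) ^ (2 r) ‖F_n‖ ^ 2`. -/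
def hperNorm {H : Type*} [NormedAddCommGroup H] [InnerProductSpace ℂ H]
    {T : ℝ} (hT : 0 < T) (r : ℝ) (F : ℝ → H) : ℝ :=
  Real.sqrt (∑' n : ℤ, (1 + |(n : ℝ)|) ^ (2 * r) * ‖fourierCoeffOn hT F n‖ ^ 2)

/-- `U` is a `T`-periodic mild solution of `U_t = A U + F`, where `A` generates `S` and `F` is
integrable on `(0,T)`: `U` is continuous, `T`-periodic and satisfies the variation of parameters
formula on `[0,T]`. -/
structure IsPeriodicMildSolution {H : Type*} [NormedAddCommGroup H] [InnerProductSpace ℂ H]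
    (S : ℝ → H →L[ℂ] H) (T : ℝ) (F U : ℝ → H) : Prop where
  forcing_integrable : IntervalIntegrable F volume 0 T
  continuous : Continuous U
  periodic : Function.Periodic U T
  variation_of_parameters : ∀ t ∈ Set.Icc (0 : ℝ) T,
    U t = S t (U 0) + ∫ s in (0 : ℝ)..t, S (t - s) (F s)

end

/-! ### Resolvent growth on the imaginary axis. -/

section Generator

variable {H : Type*} [NormedAddCommGroup H] [InnerProductSpace ℂ H]
  {A : H →ₗ.[ℂ] H} {B : H →L[ℂ] H} {S : ℝ → H →L[ℂ] H}

/-! Write `B` for the inverse of `A`, `z = is`, and `V` for the integral of `e^{-zr} S r` over `[0,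
t]`. Integrating the derivative of `e^{-zr} S r B y` shows that `V` inverts `z - A` up to the error
`e^{-zt} S t`. This error need not be small, but subtracting `e^{-zt} S t B` from `V` turns it into
`z e^{-zt} S t B`, which polynomial decay makes at most `1/2` in norm once `t` is of order `(1 +
|s|)^α`. A Neumann series then gives a resolvent whose norm is of order `t` (`exists_isResolventAt`,
`resolvent_bound`).

The periodic solution has Fourier coefficients `(iω_n - A)⁻¹ F_n`, so the resolvent bound costs
exactly the weight `(1 + |n|)^α`. Since `m ≥ 1`, all series converge absolutely and the mild formula
can be summed mode by mode (`isPeriodicMildSolution_tsum`). Uniqueness holds because decay rules out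
nonzero fixed vectors of `S T` (`eq_zero_of_fixed`). -/

theorem IsBoundedInverse.mem_graph_iff (hB : IsBoundedInverse A B) (x y : H) :
    (x, y) ∈ A.graph ↔ x = B y := by
  rw [LinearPMap.mem_graph_iff]
  constructor
  · rintro ⟨z, h1, h2⟩
    simp only at h1 h2
    rw [← h1, ← h2, hB.left_inv]
  · intro h
    obtain ⟨z, h1, h2⟩ := hB.right_inv y
    exact ⟨z, h1.trans h.symm, h2⟩

theorem IsBoundedInverse.injective (hB : IsBoundedInverse A B) {y : H} (hy : B y = 0) : y = 0 := by
  have h : ((0 : H), y) ∈ A.graph := (hB.mem_graph_iff 0 y).2 hy.symm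
  exact LinearPMap.graph_fst_eq_zero_snd _ h rfl

theorem IsC0Semigroup.tendsto_of_mem_graph (hS : IsC0Semigroup S) (hA : IsGenerator A S)
    {x y : H} (h : (x, y) ∈ A.graph) {t : ℝ} (ht : 0 ≤ t) :
    Tendsto (fun h : ℝ => h⁻¹ • (S (t + h) x - S t x)) (𝓝[>] 0) (𝓝 (S t y)) := by
  refine (((S t).continuous.tendsto y).comp ((hA x y).1 h)).congr' ?_
  filter_upwards [self_mem_nhdsWithin] with r hr
  rw [Function.comp_apply, hS.map_add t r ht (le_of_lt hr), map_real_smul (S t)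
    (S t).continuous, map_sub]
  rfl

theorem IsC0Semigroup.commute_inverse (hS : IsC0Semigroup S) (hA : IsGenerator A S)
    (hB : IsBoundedInverse A B) {t : ℝ} (ht : 0 ≤ t) (y : H) : S t (B y) = B (S t y) := by
  rw [← hB.mem_graph_iff, hA]
  have h := hS.tendsto_of_mem_graph hA ((hB.mem_graph_iff _ y).2 rfl) ht
  refine h.congr' ?_
  filter_upwards [self_mem_nhdsWithin] with r hr
  rw [add_comm, hS.map_add r t (le_of_lt hr) ht]
  rfl

/-- The generator only yields a right derivative; with continuity of the orbit this suffices for the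
fundamental theorem of calculus. -/
theorem IsC0Semigroup.hasDerivWithinAt (hS : IsC0Semigroup S) (hA : IsGenerator A S)
    (hB : IsBoundedInverse A B) {t : ℝ} (ht : 0 ≤ t) (y : H) :
    HasDerivWithinAt (fun r => S r (B y)) (S t y) (Set.Ioi t) t := by
  rw [hasDerivWithinAt_iff_tendsto_slope' (by simp)]
  have h := hS.tendsto_of_mem_graph hA ((hB.mem_graph_iff _ y).2 rfl) ht
  have h2 : Tendsto (fun r : ℝ => r - t) (𝓝[>] t) (𝓝[>] 0) := by
    refine tendsto_nhdsWithin_iff.2 ⟨?_, ?_⟩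
    · have : Tendsto (fun r : ℝ => r - t) (𝓝 t) (𝓝 (t - t)) :=
        (continuous_id.sub continuous_const).tendsto t
      rw [sub_self t] at this
      exact this.mono_left nhdsWithin_le_nhds
    · filter_upwards [self_mem_nhdsWithin] with r hr
      exact sub_pos.2 (Set.mem_Ioi.1 hr)
  refine (h.comp h2).congr fun r => ?_
  simp [slope_def_module]

theorem hasDerivAt_cexp_mul (z : ℂ) (t : ℝ) :
    HasDerivAt (fun r : ℝ => Complex.exp (-(z * r))) (-z * Complex.exp (-(z * t))) t := by
  have h : HasDerivAt (fun r : ℝ => -(z * (r : ℂ))) (-(z * 1)) t :=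
    ((Complex.ofRealCLM.hasDerivAt (x := t)).const_mul z).neg
  convert h.cexp using 1
  ring

theorem IsC0Semigroup.continuousOn_cexp_smul (hS : IsC0Semigroup S) (z : ℂ) (y : H) :
    ContinuousOn (fun r : ℝ => Complex.exp (-(z * r)) • S r y) (Set.Ici 0) :=
  ContinuousOn.smul (by fun_prop) (hS.continuousOn y)

theorem IsC0Semigroup.intervalIntegrable_cexp_smul (hS : IsC0Semigroup S) (z : ℂ) (y : H)
    {t : ℝ} (ht : 0 ≤ t) :
    IntervalIntegrable (fun r : ℝ => Complex.exp (-(z * r)) • S r y) volume 0 t := by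
  refine ContinuousOn.intervalIntegrable ((hS.continuousOn_cexp_smul z y).mono ?_)
  rw [Set.uIcc_of_le ht]
  exact Set.Icc_subset_Ici_self

theorem IsC0Semigroup.integral_cexp_smul [CompleteSpace H] (hS : IsC0Semigroup S)
    (hA : IsGenerator A S) (hB : IsBoundedInverse A B) (z : ℂ) (y : H) {t : ℝ} (ht : 0 ≤ t) :
    ∫ r in (0 : ℝ)..t, Complex.exp (-(z * r)) • S r (y - z • B y) =
      Complex.exp (-(z * t)) • S t (B y) - B y := by
  rw [intervalIntegral.integral_eq_sub_of_hasDeriv_right_of_le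
    (f := fun r : ℝ => Complex.exp (-(z * r)) • S r (B y)) ht
    ((hS.continuousOn_cexp_smul z (B y)).mono Set.Icc_subset_Ici_self) ?_
    (hS.intervalIntegrable_cexp_smul z _ ht)]
  · simp [hS.map_zero]
  · intro r hr
    convert (hasDerivAt_cexp_mul z r).hasDerivWithinAt.smul
      (hS.hasDerivWithinAt hA hB hr.1.le y) using 1
    · rfl
    simp only [map_sub, map_smul, smul_sub, smul_smul]
    rw [sub_eq_add_neg, ← neg_smul]
    congr 2
    ring

/-- The truncated Laplace transform `∫₀ᵗ e^{-zr} S(r) dr` of a semigroup, as a bounded operator. -/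
theorem IsC0Semigroup.exists_truncatedLaplace (hS : IsC0Semigroup S) {M : ℝ}
    (hM : ∀ t : ℝ, 0 ≤ t → ‖S t‖ ≤ M) (s : ℝ) {t : ℝ} (ht : 0 ≤ t) :
    ∃ V : H →L[ℂ] H, ‖V‖ ≤ M * t ∧
      ∀ y, V y = ∫ r in (0 : ℝ)..t, Complex.exp (-(Complex.I * s * r)) • S r y := by
  have hM0 : 0 ≤ M := (norm_nonneg _).trans (hM 0 le_rfl)
  let L : H →ₗ[ℂ] H :=
    { toFun := fun y => ∫ r in (0 : ℝ)..t, Complex.exp (-(Complex.I * s * r)) • S r y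
      map_add' := fun x y => by
        simp only [_root_.map_add, smul_add]
        exact intervalIntegral.integral_add (hS.intervalIntegrable_cexp_smul _ _ ht)
          (hS.intervalIntegrable_cexp_smul _ _ ht)
      map_smul' := fun c y => by
        simp only [map_smul, RingHom.id_apply]
        rw [← intervalIntegral.integral_smul]
        simp only [smul_comm c] }
  have hL : ∀ y, ‖L y‖ ≤ M * t * ‖y‖ := fun y => by
    have := intervalIntegral.norm_integral_le_of_norm_le_const (a := 0) (b := t)
      (f := fun r : ℝ => Complex.exp (-(Complex.I * s * r)) • S r y) (C := M * ‖y‖) ?_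
    · rw [sub_zero, abs_of_nonneg ht] at this
      exact this.trans (le_of_eq (by ring))
    · intro r hr
      rw [Set.uIoc_of_le ht] at hr
      rw [norm_smul, Complex.norm_exp]
      simpa using (S r).le_of_opNorm_le (hM r hr.1.le) y
  exact ⟨L.mkContinuous (M * t) hL, L.mkContinuous_norm_le (by positivity) hL, fun y => rfl⟩

theorem IsC0Semigroup.exists_isResolventAt [CompleteSpace H] (hS : IsC0Semigroup S)
    (hA : IsGenerator A S) (hB : IsBoundedInverse A B) {M : ℝ}
    (hM : ∀ t : ℝ, 0 ≤ t → ‖S t‖ ≤ M) (s : ℝ) {t : ℝ} (ht : 0 ≤ t)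
    (hsmall : |s| * ‖(S t).comp B‖ ≤ 1 / 2) :
    ∃ R : H →L[ℂ] H, IsResolventAt A (Complex.I * s) R ∧ ‖R‖ ≤ 2 * (M * t + M * ‖B‖) := by
  obtain ⟨V, hVn, hV⟩ := hS.exists_truncatedLaplace hM s ht
  set z : ℂ := Complex.I * s with hz
  have hzn : ‖z‖ = |s| := by simp [hz]
  set e : ℂ := Complex.exp (-(z * t)) with he
  have hen : ‖e‖ = 1 := by rw [he, Complex.norm_exp]; simp [hz]
  have hVP : ∀ y, V y - z • V (B y) = e • S t (B y) - B y := fun y => by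
    rw [← V.map_smul, ← V.map_sub, hV, hS.integral_cexp_smul hA hB z y ht]
  have hVB : ∀ y, V (B y) = B (V y) := fun y => by
    rw [hV, hV, ← B.intervalIntegral_comp_comm (hS.intervalIntegrable_cexp_smul z y ht)]
    refine intervalIntegral.integral_congr fun r hr => ?_
    rw [Set.uIcc_of_le ht] at hr
    simp only [map_smul]
    rw [hS.commute_inverse hA hB hr.1]
  -- In operator form, `(z - A) V = 1 - e S t`.
  have hVA : ∀ y, (V y, z • V y + e • S t y - y) ∈ A.graph := fun y => by
    rw [hB.mem_graph_iff, map_sub, _root_.map_add, map_smul, map_smul, ← hVB,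
      ← hS.commute_inverse hA hB ht, add_sub_assoc, ← hVP]
    abel
  -- The error left after the correction: `(z - A) (V - e S t B) = 1 - E`.
  set E : H →L[ℂ] H := (z * e) • (S t).comp B with hE
  have hEn : ‖E‖ ≤ 1 / 2 := by rw [hE, norm_smul, norm_mul, hen, hzn, mul_one]; exact hsmall
  have hE1 : ‖E‖ < 1 := by linarith
  let N : H →L[ℂ] H := ↑(Units.oneSub E hE1)⁻¹
  have hN : (1 - E) * N = 1 := (Units.oneSub E hE1).mul_inv
  have hNn : ‖N‖ ≤ 2 := by
    have h1 : N = 1 + E * N := by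
      rw [sub_mul, one_mul] at hN
      rw [← hN]; abel
    have h2 : ‖N‖ ≤ 1 + 1 / 2 * ‖N‖ := by
      calc ‖N‖ = ‖1 + E * N‖ := by rw [← h1]
        _ ≤ ‖(1 : H →L[ℂ] H)‖ + ‖E‖ * ‖N‖ :=
          (norm_add_le _ _).trans (add_le_add le_rfl (norm_mul_le _ _))
        _ ≤ 1 + 1 / 2 * ‖N‖ := by
          gcongr
          exact ContinuousLinearMap.norm_id_le
    linarith
  have hNy : ∀ y, N y - (z * e) • S t (B (N y)) = y := fun y => by
    have := congrArg (fun L : H →L[ℂ] H => L y) hN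
    simpa [hE] using this
  have hR : ∀ y, ∃ x : A.domain, (x : H) = ((V - e • (S t).comp B) * N) y ∧
      z • (x : H) - A x = y := fun y => by
    have h1 := hVA (N y)
    have h2 : (e • S t (B (N y)), e • S t (N y)) ∈ A.graph := by
      rw [hB.mem_graph_iff, map_smul, hS.commute_inverse hA hB ht]
    have h3 := A.graph.sub_mem h1 h2
    rw [Prod.mk_sub_mk, LinearPMap.mem_graph_iff] at h3
    obtain ⟨x, hx1, hx2⟩ := h3
    simp only at hx1 hx2
    refine ⟨x, by simpa using hx1, ?_⟩
    rw [hx1, hx2]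
    conv_rhs => rw [← hNy y]
    rw [smul_sub, smul_smul]
    abel
  -- An eigenvector for `z` satisfies `x = z B x`, which makes it a fixed point of the contraction
  -- `E`. Injectivity turns the right inverse into a two-sided one.
  have hker : ∀ x : A.domain, A x = z • (x : H) → (x : H) = 0 := fun x hx => by
    have h1 : (x : H) = z • B x := by
      rw [← map_smul, ← hx, hB.left_inv]
    have h2 := hVP x
    rw [← map_smul, ← h1, sub_self] at h2
    have h3 : E x = x := by
      conv_rhs => rw [h1, ← sub_eq_zero.1 h2.symm]
      simp [hE, mul_smul]
    have h4 := E.le_of_opNorm_le hEn (x : H)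
    rw [h3] at h4
    exact norm_le_zero_iff.1 (by linarith)
  refine ⟨(V - e • (S t).comp B) * N, ⟨fun x => ?_, hR⟩, ?_⟩
  · obtain ⟨w, hw1, hw2⟩ := hR (z • (x : H) - A x)
    rw [← hw1]
    have := hker (w - x) (by
      rw [LinearPMap.map_sub, Submodule.coe_sub, smul_sub]
      rw [sub_eq_sub_iff_sub_eq_sub] at hw2
      rw [hw2.symm])
    rwa [Submodule.coe_sub, sub_eq_zero] at this
  · have hM0 : 0 ≤ M := (norm_nonneg _).trans (hM 0 le_rfl)
    calc ‖(V - e • (S t).comp B) * N‖ ≤ ‖V - e • (S t).comp B‖ * ‖N‖ := norm_mul_le _ _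
      _ ≤ (M * t + M * ‖B‖) * 2 := by
        gcongr
        refine (norm_sub_le _ _).trans (add_le_add hVn ?_)
        rw [norm_smul, hen, one_mul]
        exact ((S t).opNorm_comp_le B).trans (by gcongr; exact hM t ht)
      _ = _ := mul_comm _ _

theorem IsPolynomiallyStable.resolvent_bound [CompleteSpace H] (hS : IsC0Semigroup S)
    (hbdd : ∃ M : ℝ, ∀ t : ℝ, 0 ≤ t → ‖S t‖ ≤ M) (hA : IsGenerator A S) {α : ℝ}
    (hstable : IsPolynomiallyStable A S α) :
    ∃ C : ℝ, ∀ s : ℝ, ∃ R : H →L[ℂ] H,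
      IsResolventAt A (Complex.I * s) R ∧ ‖R‖ ≤ C * (1 + |s|) ^ α := by
  obtain ⟨M, hM⟩ := hbdd
  obtain ⟨hα, B, hB, C, hC⟩ := hstable
  have hM0 : 0 ≤ M := (norm_nonneg _).trans (hM 0 le_rfl)
  set K : ℝ := max C 1 with hK
  have hK1 : 1 ≤ K := le_max_right _ _
  refine ⟨2 * (M * (1 + ‖B‖)) * (2 * K) ^ α, fun s => ?_⟩
  have hb : 1 ≤ 2 * K * (1 + |s|) := by nlinarith [abs_nonneg s]
  have hq : 1 ≤ (2 * K * (1 + |s|)) ^ α := Real.one_le_rpow hb hα.le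
  -- Chosen so that `(1 + t)^(-1/α) = 1 / (2K(1 + |s|))`; taking `K ≥ 1` keeps `t ≥ 0`.
  set t : ℝ := (2 * K * (1 + |s|)) ^ α - 1 with ht
  have ht0 : 0 ≤ t := by linarith
  have hpow : (1 + t) ^ (-(1 / α)) = (2 * K * (1 + |s|))⁻¹ := by
    rw [ht, add_sub_cancel, ← Real.rpow_mul (by positivity), mul_neg,
      mul_one_div_cancel hα.ne', Real.rpow_neg_one]
  have hsmall : |s| * ‖(S t).comp B‖ ≤ 1 / 2 := by
    have h1 := hC t ht0
    rw [hpow] at h1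
    have h2 : ‖(S t).comp B‖ ≤ K * (2 * K * (1 + |s|))⁻¹ :=
      h1.trans (by gcongr; exact le_max_left _ _)
    have h3 : K * (2 * K * (1 + |s|))⁻¹ = 1 / 2 * (1 + |s|)⁻¹ := by field_simp
    rw [h3] at h2
    calc |s| * ‖(S t).comp B‖ ≤ (1 + |s|) * (1 / 2 * (1 + |s|)⁻¹) := by
          gcongr; linarith
      _ = 1 / 2 := by field_simp
  obtain ⟨R, hR, hRn⟩ := hS.exists_isResolventAt hA hB hM s ht0 hsmall
  refine ⟨R, hR, hRn.trans ?_⟩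
  rw [mul_assoc, ← Real.mul_rpow (by positivity) (by positivity)]
  have h1 : (2 * K * (1 + |s|)) ^ α = 1 + t := by rw [ht]; ring
  rw [h1]
  nlinarith [mul_nonneg hM0 (norm_nonneg B), mul_nonneg (mul_nonneg hM0 (norm_nonneg B)) ht0]

end Generator

/-! ### Vector-valued Fourier series. -/

section FourierSeries

variable {H : Type*} [NormedAddCommGroup H] [InnerProductSpace ℂ H] {T : ℝ}

/-- The angular frequency `2πn/T` of the `n`-th Fourier mode of period `T`. -/
noncomputable def angularFreq (T : ℝ) (n : ℤ) : ℝ := 2 * Real.pi * n / T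

theorem norm_cexp_I_mul (s x : ℝ) : ‖Complex.exp (Complex.I * s * x)‖ = 1 := by
  rw [Complex.norm_exp]; simp

theorem cexp_angularFreq_add (hT : 0 < T) (n : ℤ) (x : ℝ) :
    Complex.exp (Complex.I * angularFreq T n * ((x + T : ℝ) : ℂ)) =
      Complex.exp (Complex.I * angularFreq T n * x) := by
  have hT' : (T : ℂ) ≠ 0 := by exact_mod_cast hT.ne'
  rw [Complex.exp_eq_exp_iff_exists_int]
  refine ⟨n, ?_⟩
  simp only [angularFreq]
  push_cast
  field_simp

theorem fourierCoeffOn_eq_integral_cexp (hT : 0 < T) (f : ℝ → H) (n : ℤ) :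
    fourierCoeffOn hT f n =
      (1 / T) • ∫ x in (0 : ℝ)..T, Complex.exp (-(Complex.I * angularFreq T n * x)) • f x := by
  rw [fourierCoeffOn_eq_integral, sub_zero]
  congr 1
  refine intervalIntegral.integral_congr fun x _ => ?_
  simp only [fourier_coe_apply, angularFreq]
  congr 2
  push_cast
  ring

theorem integral_cexp_mul_cexp (hT : 0 < T) (n k : ℤ) :
    ∫ x in (0 : ℝ)..T, Complex.exp (-(Complex.I * angularFreq T n * x)) *
      Complex.exp (Complex.I * angularFreq T k * x) = if k = n then (T : ℂ) else 0 := by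
  have hT' : (T : ℂ) ≠ 0 := by exact_mod_cast hT.ne'
  have h1 : ∀ x : ℝ, Complex.exp (-(Complex.I * angularFreq T n * x)) *
      Complex.exp (Complex.I * angularFreq T k * x) =
      Complex.exp (Complex.I * angularFreq T (k - n) * x) := fun x => by
    rw [← Complex.exp_add]
    congr 1
    simp only [angularFreq]
    push_cast
    ring
  simp only [h1]
  split_ifs with h
  · subst h
    simp [angularFreq]
  · have hkn : ((k : ℂ) - n) ≠ 0 := by
      rw [sub_ne_zero]; exact_mod_cast h
    rw [integral_exp_mul_complex]
    · have h2 := cexp_angularFreq_add hT (k - n) 0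
      rw [zero_add] at h2
      rw [h2, sub_self, zero_div]
    · simp only [angularFreq]
      push_cast
      have : (Real.pi : ℂ) ≠ 0 := by exact_mod_cast Real.pi_ne_zero
      refine mul_ne_zero Complex.I_ne_zero (div_ne_zero (mul_ne_zero (mul_ne_zero two_ne_zero this) hkn) hT')

theorem fourierCoeffOn_of_hasSum [CompleteSpace H] (hT : 0 < T) {c : ℤ → H}
    (hc : Summable fun k => ‖c k‖) {G : ℝ → H}
    (hG : ∀ x : ℝ, HasSum (fun k => Complex.exp (Complex.I * angularFreq T k * x) • c k) (G x))
    (n : ℤ) : fourierCoeffOn hT G n = c n := by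
  rw [fourierCoeffOn_eq_integral_cexp]
  have h1 := intervalIntegral.hasSum_integral_of_dominated_convergence (a := 0) (b := T)
    (μ := volume) (f := fun x : ℝ => Complex.exp (-(Complex.I * angularFreq T n * x)) • G x)
    (F := fun k (x : ℝ) => Complex.exp (-(Complex.I * angularFreq T n * x)) •
      Complex.exp (Complex.I * angularFreq T k * x) • c k)
    (fun k _ => ‖c k‖)
    (fun k => (Continuous.aestronglyMeasurable (by fun_prop)))
    (fun k => ae_of_all _ fun x _ => by
      have := norm_cexp_I_mul (-angularFreq T n) x
      rw [Complex.ofReal_neg, mul_neg, neg_mul] at this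
      rw [norm_smul, norm_smul, norm_cexp_I_mul, this, one_mul, one_mul])
    (ae_of_all _ fun x _ => hc) intervalIntegrable_const
    (ae_of_all _ fun x _ => (hG x).const_smul _)
  have h2 : ∀ k, ∫ x in (0 : ℝ)..T, Complex.exp (-(Complex.I * angularFreq T n * x)) •
      Complex.exp (Complex.I * angularFreq T k * x) • c k =
      if k = n then (T : ℂ) • c n else 0 := fun k => by
    simp only [smul_smul]
    rw [intervalIntegral.integral_smul_const, integral_cexp_mul_cexp hT]
    split_ifs with h
    · rw [h]
    · rw [zero_smul]
  simp only [h2] at h1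
  rw [h1.unique (hasSum_ite_eq n _), Complex.coe_smul, smul_smul, one_div_mul_cancel hT.ne',
    one_smul]

theorem ae_eq_zero_of_fourierCoeffOn_eq_zero (hT : 0 < T) {f : ℝ → ℂ}
    (hf : MemLp f 2 (volume.restrict (Set.Ioc 0 T))) (h : ∀ n, fourierCoeffOn hT f n = 0) :
    f =ᵐ[volume.restrict (Set.Ioc 0 T)] 0 := by
  have h1 := hasSum_sq_fourierCoeffOn hT hf
  simp only [h, norm_zero, ne_eq, OfNat.ofNat_ne_zero, not_false_eq_true, zero_pow, sub_zero] at h1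
  have h2 := h1.unique hasSum_zero
  rw [smul_eq_zero, or_iff_right (inv_ne_zero hT.ne'), intervalIntegral.integral_of_le hT.le,
    integral_eq_zero_iff_of_nonneg (fun x => by positivity) (hf.integrable_norm_pow (by simp))] at h2
  filter_upwards [h2] with x hx
  simpa using hx

/-- Continuous functionals reduce this to the scalar case, where Parseval applies. -/
theorem ae_eq_of_fourierCoeffOn_eq [CompleteSpace H] (hT : 0 < T) {F G : ℝ → H}
    (hF : MemLp F 2 (volume.restrict (Set.Ioc 0 T)))
    (hG : MemLp G 2 (volume.restrict (Set.Ioc 0 T)))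
    (h : ∀ n, fourierCoeffOn hT F n = fourierCoeffOn hT G n) :
    F =ᵐ[volume.restrict (Set.Ioc 0 T)] G := by
  have hD := hF.sub hG
  have hint : ∀ {f : ℝ → H}, MemLp f 2 (volume.restrict (Set.Ioc 0 T)) → ∀ n : ℤ,
      IntervalIntegrable (fun x : ℝ => Complex.exp (-(Complex.I * angularFreq T n * x)) • f x)
        volume 0 T := fun {f} hf n => by
    have : IntervalIntegrable f volume 0 T := by
      rw [intervalIntegrable_iff_integrableOn_Ioc_of_le hT.le]
      exact hf.integrable (by norm_num)
    exact this.continuousOn_smul (by fun_prop)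
  have hcoef : ∀ n, ∫ x in (0 : ℝ)..T,
      Complex.exp (-(Complex.I * angularFreq T n * x)) • (F - G) x = 0 := fun n => by
    have h1 := h n
    rw [fourierCoeffOn_eq_integral_cexp, fourierCoeffOn_eq_integral_cexp] at h1
    have h2 := smul_right_injective H (one_div_ne_zero hT.ne') h1
    simp only [Pi.sub_apply, smul_sub]
    rw [intervalIntegral.integral_sub (hint hF n) (hint hG n), sub_eq_zero]
    exact h2
  -- A strongly measurable representative has separable range, so testing against each functional
  -- separately suffices even if `H` is not separable.
  obtain ⟨g, hg, hfg⟩ := hD.1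
  have h0 : F - G =ᵐ[volume.restrict (Set.Ioc 0 T)] 0 := by
    refine ae_eq_zero_of_forall_dual_of_isSeparable ℂ hg.isSeparable_range (fun c => ?_)
      (by filter_upwards [hfg] with x hx; rw [hx]; exact Set.mem_range_self x)
    refine ae_eq_zero_of_fourierCoeffOn_eq_zero hT (c.comp_memLp' hD) fun n => ?_
    rw [fourierCoeffOn_eq_integral_cexp]
    have h1 := c.intervalIntegral_comp_comm (hint hD n)
    rw [hcoef, map_zero] at h1
    simp only [map_smul] at h1
    rw [h1, smul_zero]
  exact sub_ae_eq_zero _ _ |>.1 h0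

theorem one_le_one_add_abs (n : ℤ) : 1 ≤ 1 + |(n : ℝ)| := by
  linarith [abs_nonneg (n : ℝ)]

theorem summable_of_summable_rpow_mul_sq {a : ℤ → ℝ} (ha : ∀ n, 0 ≤ a n) {m : ℝ} (hm : 1 ≤ m)
    (h : Summable fun n : ℤ => (1 + |(n : ℝ)|) ^ (2 * m) * a n ^ 2) : Summable a := by
  have h1 : Summable fun n : ℤ => ((1 + |(n : ℝ)|) ^ 2)⁻¹ := by
    have h2 : Summable fun n : ℤ => ((n : ℝ) ^ 2)⁻¹ := by
      simpa using (Real.summable_one_div_int_pow (p := 2)).2 (by norm_num)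
    refine Summable.of_norm_bounded_eventually h2 ?_
    -- At `n = 0` the comparison term is `0⁻¹ = 0`, so the bound fails there.
    have : ∀ᶠ n : ℤ in cofinite, n ≠ 0 := by
      rw [Filter.eventually_cofinite]
      simp
    filter_upwards [this] with n hn
    rw [Real.norm_of_nonneg (by positivity)]
    have : 0 < |(n : ℝ)| := by positivity
    rw [← sq_abs (n : ℝ)]
    gcongr
    linarith
  refine Summable.of_nonneg_of_le ha (fun n => ?_) (h.add h1)
  have hb := one_le_one_add_abs n
  have h3 : (1 + |(n : ℝ)|) ^ 2 ≤ (1 + |(n : ℝ)|) ^ (2 * m) := by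
    rw [← Real.rpow_two]
    exact Real.rpow_le_rpow_of_exponent_le hb (by linarith)
  -- Young's inequality applied to `a = (b a) b⁻¹`.
  have h4 : a n ≤ (1 + |(n : ℝ)|) ^ 2 * a n ^ 2 + ((1 + |(n : ℝ)|) ^ 2)⁻¹ := by
    set b := 1 + |(n : ℝ)|
    have h5 : b * b⁻¹ = 1 := mul_inv_cancel₀ (by positivity)
    rw [← inv_pow]
    have h6 : (b * a n) * b⁻¹ = a n := by rw [mul_right_comm, h5, one_mul]
    nlinarith [sq_nonneg (b * a n - b⁻¹), sq_nonneg (b * a n), sq_nonneg b⁻¹]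
  refine h4.trans (by gcongr)

end FourierSeries

/-! ### Uniqueness and construction of periodic mild solutions. -/

section PeriodicMildSolution

variable {H : Type*} [NormedAddCommGroup H] [InnerProductSpace ℂ H]
  {A : H →ₗ.[ℂ] H} {B : H →L[ℂ] H} {S : ℝ → H →L[ℂ] H}

/-- A fixed vector satisfies `B x = S (nT) B x` for every `n`, and the right side decays. -/
theorem IsC0Semigroup.eq_zero_of_fixed (hS : IsC0Semigroup S) (hA : IsGenerator A S) {α : ℝ}
    (hstable : IsPolynomiallyStable A S α) {T : ℝ} (hT : 0 < T) {x : H} (hx : S T x = x) :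
    x = 0 := by
  obtain ⟨hα, B, hB, C, hC⟩ := hstable
  refine hB.injective ?_
  have hn : ∀ n : ℕ, S (n * T) x = x := fun n => by
    induction n with
    | zero => simp [hS.map_zero]
    | succ k ih =>
      rw [Nat.cast_succ, add_mul, one_mul, hS.map_add _ _ (by positivity) hT.le,
        ContinuousLinearMap.comp_apply, hx, ih]
  have hbound : ∀ n : ℕ, ‖B x‖ ≤ C * (1 + n * T) ^ (-(1 / α)) * ‖x‖ := fun n => by
    have h0 : (0 : ℝ) ≤ n * T := by positivity
    have h1 := ((S (n * T)).comp B).le_of_opNorm_le (hC _ h0) x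
    rwa [ContinuousLinearMap.comp_apply, hS.commute_inverse hA hB h0, hn] at h1
  have hlim : Tendsto (fun n : ℕ => C * (1 + n * T) ^ (-(1 / α)) * ‖x‖) atTop
      (𝓝 (C * 0 * ‖x‖)) := by
    refine (Tendsto.const_mul C ?_).mul_const _
    refine (tendsto_rpow_neg_atTop (one_div_pos.2 hα)).comp ?_
    exact tendsto_atTop_add_const_left _ _ (tendsto_natCast_atTop_atTop.atTop_mul_const hT)
  rw [mul_zero, zero_mul] at hlim
  exact norm_le_zero_iff.1 (ge_of_tendsto' hlim hbound)

theorem IsPeriodicMildSolution.unique (hS : IsC0Semigroup S) (hA : IsGenerator A S) {α : ℝ}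
    (hstable : IsPolynomiallyStable A S α) {T : ℝ} (hT : 0 < T) {F U V : ℝ → H}
    (hU : IsPeriodicMildSolution S T F U) (hV : IsPeriodicMildSolution S T F V) : U = V := by
  have hdiff : ∀ t ∈ Set.Icc (0 : ℝ) T, U t - V t = S t (U 0 - V 0) := fun t ht => by
    rw [hU.variation_of_parameters t ht, hV.variation_of_parameters t ht, map_sub]
    abel
  have hfix := hdiff T ⟨hT.le, le_rfl⟩
  have hUT : U T = U 0 := by simpa using hU.periodic 0
  have hVT : V T = V 0 := by simpa using hV.periodic 0
  rw [hUT, hVT] at hfix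
  have hzero := hS.eq_zero_of_fixed hA hstable hT hfix.symm
  funext t
  obtain ⟨y, hy, hty⟩ := (hU.periodic.sub hV.periodic).exists_mem_Ico₀ hT t
  have := hdiff y ⟨hy.1, hy.2.le⟩
  rw [hzero, map_zero] at this
  rw [← sub_eq_zero]
  exact hty.trans this

/-- The mild formula for a single mode. With `y = A (R f)` one has `y - z B y = -f`, so reversing
time in the integral reduces it to `integral_cexp_smul`. -/
theorem IsC0Semigroup.resolvent_variation_of_parameters [CompleteSpace H] (hS : IsC0Semigroup S)
    (hA : IsGenerator A S) (hB : IsBoundedInverse A B) {z : ℂ} {R : H →L[ℂ] H}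
    (hR : IsResolventAt A z R) (f : H) {t : ℝ} (ht : 0 ≤ t) :
    Complex.exp (z * t) • R f =
      S t (R f) + ∫ r in (0 : ℝ)..t, S (t - r) (Complex.exp (z * r) • f) := by
  obtain ⟨x, hx1, hx2⟩ := hR.right_inv f
  have h1 : B (A x) = R f := by rw [hB.left_inv, hx1]
  have h2 := hS.integral_cexp_smul hA hB z (A x) ht
  rw [h1, ← neg_sub, ← hx1, hx2, hx1] at h2
  have h3 : ∫ r in (0 : ℝ)..t, S (t - r) (Complex.exp (z * r) • f) =
      -(Complex.exp (z * t) • ∫ r in (0 : ℝ)..t, Complex.exp (-(z * r)) • S r (-f)) := by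
    rw [← intervalIntegral.integral_smul, ← intervalIntegral.integral_neg]
    have h4 := intervalIntegral.integral_comp_sub_left (a := 0) (b := t)
      (fun r : ℝ => S r (Complex.exp (z * ((t - r : ℝ) : ℂ)) • f)) t
    simp only [sub_sub_cancel, sub_self, sub_zero] at h4
    rw [h4]
    refine intervalIntegral.integral_congr fun r _ => ?_
    simp only [map_smul, map_neg, smul_neg, neg_neg, smul_smul]
    rw [← Complex.exp_add]
    congr 2
    push_cast
    ring
  rw [h3, h2, smul_sub, smul_smul, ← Complex.exp_add, add_neg_cancel, Complex.exp_zero, one_smul]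
  abel

theorem MemHper.intervalIntegrable {T : ℝ} {hT : 0 < T} {r : ℝ} {F : ℝ → H}
    (hF : MemHper hT r F) : IntervalIntegrable F volume 0 T := by
  rw [intervalIntegrable_iff_integrableOn_Ioc_of_le hT.le]
  exact hF.memLp.integrable (by norm_num)

theorem Continuous.memLp_two_restrict_Ioc {H : Type*} [NormedAddCommGroup H] {T : ℝ} {G : ℝ → H} (hG : Continuous G) :
    MemLp G 2 (volume.restrict (Set.Ioc 0 T)) := by
  obtain ⟨K, hK⟩ := isCompact_Icc.exists_bound_of_continuousOn (s := Set.Icc 0 T) hG.continuousOn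
  refine MemLp.of_bound hG.aestronglyMeasurable K ?_
  filter_upwards [ae_restrict_mem measurableSet_Ioc] with x hx
  exact hK x (Set.Ioc_subset_Icc_self hx)

theorem continuous_tsum_cexp_smul [CompleteSpace H] (T : ℝ) {c : ℤ → H} (hc : Summable fun k => ‖c k‖) :
    Continuous fun x : ℝ => ∑' k, Complex.exp (Complex.I * angularFreq T k * x) • c k :=
  continuous_tsum (fun k => by fun_prop) hc fun k x => by
    rw [norm_smul, norm_cexp_I_mul, one_mul]

theorem hasSum_cexp_smul [CompleteSpace H] (T : ℝ) {c : ℤ → H} (hc : Summable fun k => ‖c k‖) (x : ℝ) :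
    HasSum (fun k => Complex.exp (Complex.I * angularFreq T k * x) • c k)
      (∑' k, Complex.exp (Complex.I * angularFreq T k * x) • c k) := by
  refine Summable.hasSum (Summable.of_norm ?_)
  simpa only [norm_smul, norm_cexp_I_mul, one_mul] using hc

theorem periodic_tsum_cexp_smul {T : ℝ} (hT : 0 < T) (c : ℤ → H) :
    Function.Periodic
      (fun x : ℝ => ∑' k, Complex.exp (Complex.I * angularFreq T k * x) • c k) T := fun x => by
  simp only [cexp_angularFreq_add hT]

/-- The Fourier series of `(is_n - A)⁻¹ F_n` solves the periodic problem with forcing `F`. -/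
theorem IsC0Semigroup.isPeriodicMildSolution_tsum [CompleteSpace H] (hS : IsC0Semigroup S)
    (hbdd : ∃ M : ℝ, ∀ t : ℝ, 0 ≤ t → ‖S t‖ ≤ M) (hA : IsGenerator A S)
    (hB : IsBoundedInverse A B) {T : ℝ} {hT : 0 < T} {R : ℤ → H →L[ℂ] H}
    (hR : ∀ n, IsResolventAt A (Complex.I * angularFreq T n) (R n)) {r : ℝ} {F : ℝ → H}
    (hF : MemHper hT r F) (hFs : Summable fun n => ‖fourierCoeffOn hT F n‖)
    (hUs : Summable fun n => ‖R n (fourierCoeffOn hT F n)‖) :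
    IsPeriodicMildSolution S T F (fun x : ℝ =>
      ∑' n, Complex.exp (Complex.I * angularFreq T n * x) • R n (fourierCoeffOn hT F n)) := by
  refine ⟨hF.intervalIntegrable, continuous_tsum_cexp_smul T hUs, periodic_tsum_cexp_smul hT _,
    fun t ht => ?_⟩
  obtain ⟨M, hM⟩ := hbdd
  set c := fun n => fourierCoeffOn hT F n with hc
  have hGc := continuous_tsum_cexp_smul T hFs
  -- `F` agrees almost everywhere with its absolutely convergent Fourier series, which may replace
  -- it under the integral.
  have hFG := ae_eq_of_fourierCoeffOn_eq hT hF.memLp (hGc.memLp_two_restrict_Ioc (T := T))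
    fun n => (fourierCoeffOn_of_hasSum hT hFs (hasSum_cexp_smul T hFs) n).symm
  rw [Filter.EventuallyEq, ae_restrict_iff' measurableSet_Ioc] at hFG
  have hint : HasSum (fun n => ∫ s in (0 : ℝ)..t,
      S (t - s) (Complex.exp (Complex.I * angularFreq T n * s) • c n))
      (∫ s in (0 : ℝ)..t, S (t - s) (F s)) := by
    refine intervalIntegral.hasSum_integral_of_dominated_convergence
      (fun n _ => M * ‖c n‖) (fun n => ?_) (fun n => ae_of_all _ fun s hs => ?_)
      (ae_of_all _ fun s _ => hFs.mul_left M) intervalIntegrable_const ?_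
    · simp only [map_smul]
      rw [Set.uIoc_of_le ht.1]
      refine ContinuousOn.aestronglyMeasurable ?_ measurableSet_Ioc
      refine ContinuousOn.smul (by fun_prop) ?_
      exact (hS.continuousOn (c n)).comp (by fun_prop) fun s hs => sub_nonneg.2 hs.2
    · rw [Set.uIoc_of_le ht.1] at hs
      refine ((S (t - s)).le_of_opNorm_le (hM _ (sub_nonneg.2 hs.2)) _).trans (le_of_eq ?_)
      rw [norm_smul, norm_cexp_I_mul, one_mul]
    · filter_upwards [hFG] with s hs hst
      rw [Set.uIoc_of_le ht.1] at hst
      rw [hs ⟨hst.1, hst.2.trans ht.2⟩]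
      exact (hasSum_cexp_smul T hFs s).mapL (S (t - s))
  have h0 := (hasSum_cexp_smul T hUs 0).mapL (S t)
  refine (hasSum_cexp_smul T hUs t).unique ?_
  convert h0.add hint using 2 with n
  rw [hS.resolvent_variation_of_parameters hA hB (hR n) _ ht.1]
  simp [hc]

/-- A polynomial bound for the resolvent at the Fourier frequencies, in terms of the index. -/
theorem exists_norm_resolvent_angularFreq_le {C α : ℝ} (hα : 0 < α) {T : ℝ} (hT : 0 < T) :
    ∃ K : ℝ, 0 ≤ K ∧ ∀ n : ℤ, C * (1 + |angularFreq T n|) ^ α ≤ K * (1 + |(n : ℝ)|) ^ α := by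
  set q : ℝ := max 1 (2 * Real.pi / T) with hq
  have hq0 : 0 ≤ q := zero_le_one.trans (le_max_left _ _)
  refine ⟨|C| * q ^ α, by positivity, fun n => ?_⟩
  have h1 : 1 + |angularFreq T n| ≤ q * (1 + |(n : ℝ)|) := by
    have h2 : |angularFreq T n| = 2 * Real.pi / T * |(n : ℝ)| := by
      rw [angularFreq, mul_div_right_comm, abs_mul, abs_of_pos (by positivity)]
    rw [h2, mul_add, mul_one]
    gcongr
    · exact le_max_left _ _
    · exact le_max_right _ _
  rw [mul_assoc, ← Real.mul_rpow hq0 (by positivity)]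
  exact mul_le_mul (le_abs_self C) (Real.rpow_le_rpow (by positivity) h1 hα.le)
    (by positivity) (abs_nonneg C)

end PeriodicMildSolution

/-! ### The main theorem. -/

theorem theorem1 {H : Type*} [NormedAddCommGroup H] [InnerProductSpace ℂ H] [CompleteSpace H]
    (S : ℝ → H →L[ℂ] H) (A : H →ₗ.[ℂ] H) (hS : IsC0Semigroup S)
    (hbdd : ∃ M : ℝ, ∀ t : ℝ, 0 ≤ t → ‖S t‖ ≤ M) (hA : IsGenerator A S)
    (α : ℝ) (hstable : IsPolynomiallyStable A S α) :
    (∃ C : ℝ, ∀ s : ℝ, ∃ R : H →L[ℂ] H,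
      IsResolventAt A (Complex.I * s) R ∧ ‖R‖ ≤ C * (1 + |s|) ^ α) ∧
    ∀ (T : ℝ) (hT : 0 < T), ∃ C : ℝ, ∀ m : ℝ, 1 ≤ m →
      ∀ F : ℝ → H, MemHper hT (m + α) F →
        (∃! U : ℝ → H, IsPeriodicMildSolution S T F U) ∧
        ∀ U : ℝ → H, IsPeriodicMildSolution S T F U →
          MemHper hT m U ∧ hperNorm hT m U ≤ C * hperNorm hT (m + α) F := by
  have hres := hstable.resolvent_bound hS hbdd hA
  refine ⟨hres, fun T hT => ?_⟩
  obtain ⟨C, hC⟩ := hres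
  have hα := hstable.1
  obtain ⟨B, hB, -⟩ := hstable.2
  obtain ⟨K, hK0, hK⟩ := exists_norm_resolvent_angularFreq_le (C := C) hα hT
  choose R hR hRn using fun n : ℤ => hC (angularFreq T n)
  -- `K` is fixed before `m` and `F`, so the estimate is uniform in both.
  refine ⟨K, fun m hm F hF => ?_⟩
  have hle : ∀ n : ℤ, (1 + |(n : ℝ)|) ^ (2 * m) * ‖R n (fourierCoeffOn hT F n)‖ ^ 2 ≤
      K ^ 2 * ((1 + |(n : ℝ)|) ^ (2 * (m + α)) * ‖fourierCoeffOn hT F n‖ ^ 2) := fun n => by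
    have hb : 0 < 1 + |(n : ℝ)| := by positivity
    have h1 := (R n).le_of_opNorm_le ((hRn n).trans (hK n)) (fourierCoeffOn hT F n)
    calc (1 + |(n : ℝ)|) ^ (2 * m) * ‖R n (fourierCoeffOn hT F n)‖ ^ 2
        ≤ (1 + |(n : ℝ)|) ^ (2 * m) *
          (K * (1 + |(n : ℝ)|) ^ α * ‖fourierCoeffOn hT F n‖) ^ 2 := by gcongr
      _ = _ := by
        rw [mul_add, Real.rpow_add hb, two_mul α, Real.rpow_add hb]
        ring
  have hUsq := Summable.of_nonneg_of_le (fun n => by positivity) hle (hF.summable.mul_left (K ^ 2))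
  have hUs := summable_of_summable_rpow_mul_sq (fun n => norm_nonneg _) hm hUsq
  have hFs := summable_of_summable_rpow_mul_sq (fun n => norm_nonneg _)
    (by linarith : 1 ≤ m + α) hF.summable
  have hU := hS.isPeriodicMildSolution_tsum hbdd hA hB hR hF hFs hUs
  refine ⟨⟨_, hU, fun V hV => hV.unique hS hA hstable hT hU⟩, fun V hV => ?_⟩
  rw [hV.unique hS hA hstable hT hU]
  have hcoef := fourierCoeffOn_of_hasSum hT hUs (hasSum_cexp_smul T hUs)
  refine ⟨⟨hU.periodic, hU.continuous.memLp_two_restrict_Ioc, ?_⟩, ?_⟩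
  · simp only [hcoef]
    exact hUsq
  · simp only [hperNorm, hcoef]
    refine Real.sqrt_le_iff.2 ⟨by positivity, ?_⟩
    rw [mul_pow, Real.sq_sqrt (tsum_nonneg fun n => by positivity), ← tsum_mul_left]
    exact hUsq.tsum_le_tsum hle (hF.summable.mul_left (K ^ 2))
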